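/- A non-degenerate symmetric set $(X,r)$ is a nonempty set $X$ with a map $r:X\times X\to X\times X$, $r(x,y)=({}^xy,x^y)$, such that $r^2=\mathrm{id}$, $r^{12}r^{23}r^{12}=r^{23}r^{12}r^{23}$ on $X^3$, and for every $x$ the maps $\mathcal L_x:y\mapsto{}^xy$ and $\mathcal R_x:y\mapsto y^x$ are bijective. Its retraction $\mathrm{Ret}(X,r)$ is the symmetric set induced on $X/{\sim}$, where $x\sim y$ iff $\mathcal L_x=\mathcal L_y$; put $\mathrm{Ret}^0(X,r)=(X,r)$ and $\mathrm{Ret}^{k+1}(X,r)=\mathrm{Ret}(\mathrm{Ret}^{k}(X,r))$. If some $\mathrm{Ret}^k(X,r)$ has exactly one element, $(X,r)$ is called a multipermutation solution, and the least such $k\ge 0$ is its (finite) multipermutation level $\mathrm{mpl}\,X$. Let $G=G(X,r)$ be the group generated by $X$ with relations $xy=({}^xy)(x^y)$, $x,y\in X$, and let $r_G:G\times G\to G\times G$ be the unique braiding operator on $G$ extending $r$ along $X\to G$; that is, writing $r_G(a,b)=({}^ab,a^b)$, the group $G$ acts on the set $G$ from the left by ${}^ab$ and from the right by $a^b$, with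 ${}^a1=1$, $1^a=1$, ${}^a(bc)=({}^ab)({}^{a^b}c)$, $(ab)^c=(a^{{}^bc})(b^c)$ and $ab=({}^ab)(a^b)$. Let $\mathcal G=\mathcal G(X,r)$ be the image of the homomorphism $\mathcal L:G\to\mathrm{Sym}(X)$, $x\mapsto\mathcal L_x$, with the induced braiding operator $r_{\mathcal G}(\mathcal L_a,\mathcal L_b)=(\mathcal L_{{}^ab},\mathcal L_{a^b})$. Both $(G,r_G)$ and $(\mathcal G,r_{\mathcal G})$ are non-degenerate symmetric sets, and $\mathrm{mpl}\,G$, $\mathrm{mpl}\,\mathcal G$ denote their multipermutation levels. **Theorem.** Let $(X,r)$ be a non-degenerate symmetric set (not necessarily finite) with $|X|\ge 2$. 1. $(G,r_G)$ has finite multipermutation level if and only if $(X,r)$ is a multipermutation solution. In this case, with $m=\mathrm{mpl}(G,r_G)$, the level $\mathrm{mpl}(\mathcal G,r_{\mathcal G})$ is finite and $$0\le \mathrm{mpl}(\mathcal G,r_{\mathcal G})=m-1\le \mathrm{mpl}(X,r)\le \mathrm{mpl}(G,r_G)=m<\infty .$$ 2. Suppose furthermore that for every $x\in X$ there is some $a\in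 X$ with ${}^ax=x$. Then for every integer $m\ge 0$, $\mathrm{mpl}\,X=m$ if and only if $\mathrm{mpl}\,G=m$. In particular, this holds whenever $(X,r)$ is square-free, i.e. $r(x,x)=(x,x)$ for all $x\in X$. -/

import Mathlib

/-!
Non-degenerate symmetric sets, their retractions and multipermutation level, the symmetric groups
`G(X,r)` and `𝒢(X,r)` with their braiding operators.
-/

universe u

/-- The map `r × id` on triples. -/
def braid12 {X : Type u} (r : X × X → X × X) (t : X × X × X) : X × X × X :=
  ((r (t.1, t.2.1)).1, (r (t.1, t.2.1)).2, t.2.2)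

/-- The map `id × r` on triples. -/
def braid23 {X : Type u} (r : X × X → X × X) (t : X × X × X) : X × X × X :=
  (t.1, r t.2)

/-- A non-degenerate symmetric set `(X, r)`: a nonempty set with a non-degenerate involutive
set-theoretic solution `r (x, y) = (ˣy, xʸ)` of the Yang-Baxter equation. -/
structure SymmetricSet : Type (u + 1) where
  carrier : Type u
  nonempty : Nonempty carrier
  r : carrier × carrier → carrier × carrier
  involutive : ∀ p, r (r p) = p
  nondegenerate_left : ∀ x, Function.Bijective (fun y => (r (x, y)).1)
  nondegenerate_right : ∀ y, Function.Bijective (fun x => (r (x, y)).2)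
  braid : ∀ t, braid12 r (braid23 r (braid12 r t)) = braid23 r (braid12 r (braid23 r t))

namespace SymmetricSet

/-- The left action `ˣy`. -/
def act (S : SymmetricSet.{u}) (x y : S.carrier) : S.carrier := (S.r (x, y)).1

/-- The right action `xʸ`. -/
def ract (S : SymmetricSet.{u}) (x y : S.carrier) : S.carrier := (S.r (x, y)).2

variable (S : SymmetricSet.{u})

theorem act_inj {x y z : S.carrier} (h : S.act x y = S.act x z) : y = z :=
  (S.nondegenerate_left x).1 h

theorem ract_inj {x y z : S.carrier} (h : S.ract y x = S.ract z x) : y = z :=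
  (S.nondegenerate_right x).1 h

theorem inv1 (x y : S.carrier) : S.act (S.act x y) (S.ract x y) = x :=
  congrArg Prod.fst (S.involutive (x, y))

theorem inv2 (x y : S.carrier) : S.ract (S.act x y) (S.ract x y) = y :=
  congrArg Prod.snd (S.involutive (x, y))

theorem l1 (x y z : S.carrier) :
    S.act x (S.act y z) = S.act (S.act x y) (S.act (S.ract x y) z) :=
  (congrArg Prod.fst (S.braid (x, y, z))).symm

theorem act_eq_iff (z y : S.carrier) : S.act z y = z ↔ S.ract z y = y := by
  constructor
  · intro h
    have h1 := S.inv1 z y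
    rw [h] at h1
    exact S.act_inj (h1.trans h.symm)
  · intro h
    have h1 := S.inv2 z y
    rw [h] at h1
    exact S.ract_inj (h1.trans h.symm)

/-- For every `y` there is `z` with `ᶻy = z`. -/
theorem exists_act_eq (y : S.carrier) : ∃ z, S.act z y = z := by
  obtain ⟨z, hz⟩ := (S.nondegenerate_right y).2 y
  exact ⟨z, (S.act_eq_iff z y).2 hz⟩

theorem act_eq_unique {y z z' : S.carrier} (h : S.act z y = z) (h' : S.act z' y = z') :
    z = z' :=
  S.ract_inj (((S.act_eq_iff z y).1 h).trans ((S.act_eq_iff z' y).1 h').symm)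

theorem act_ract_eq {x y z : S.carrier} (h : S.act z (S.act x y) = z) :
    S.act (S.ract z x) y = S.ract z x := by
  have h1 := S.l1 z x y
  rw [h] at h1
  exact S.act_inj (h1.symm.trans (S.inv1 z x).symm)

theorem ract_eq_of_act_eq {x x' : S.carrier} (h : ∀ z, S.act x z = S.act x' z)
    (z : S.carrier) : S.ract z x = S.ract z x' := by
  -- write `z` as the element with `ᶻ(ˣy) = z`
  obtain ⟨w, hw⟩ := (S.nondegenerate_left z).2 z
  obtain ⟨y, hy⟩ := (S.nondegenerate_left x).2 w
  have hw' : S.act z w = z := hw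
  have hy' : S.act x y = w := hy
  have h1 : S.act z (S.act x y) = z := by rw [hy', hw']
  have h2 : S.act z (S.act x' y) = z := by rw [← h, hy', hw']
  exact S.act_eq_unique (S.act_ract_eq h1) (S.act_ract_eq h2)

/-! ### Retraction -/

/-- `x ∼ y` iff `ℒ_x = ℒ_y`. -/
def retSetoid : Setoid S.carrier where
  r x y := ∀ z, S.act x z = S.act y z
  iseqv := ⟨fun _ _ => rfl, fun h z => (h z).symm, fun h h' z => (h z).trans (h' z)⟩

theorem act_rel_right {x y y' : S.carrier} (h : ∀ z, S.act y z = S.act y' z) (z : S.carrier) :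
    S.act (S.act x y) z = S.act (S.act x y') z := by
  obtain ⟨w, rfl⟩ := (S.nondegenerate_left (S.ract x y)).2 z
  change S.act (S.act x y) (S.act (S.ract x y) w) = S.act (S.act x y') (S.act (S.ract x y) w)
  rw [← S.l1, S.ract_eq_of_act_eq h, ← S.l1, h]

theorem ract_rel_left {x x' y : S.carrier} (h : ∀ z, S.act x z = S.act x' z) (z : S.carrier) :
    S.act (S.ract x y) z = S.act (S.ract x' y) z := by
  apply S.act_inj (x := S.act x y)
  rw [← S.l1, h y, ← S.l1, h]

theorem r_rel {x x' y y' : S.carrier} (hx : ∀ z, S.act x z = S.act x' z)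
    (hy : ∀ z, S.act y z = S.act y' z) :
    (∀ z, S.act (S.act x y) z = S.act (S.act x' y') z) ∧
    (∀ z, S.act (S.ract x y) z = S.act (S.ract x' y') z) := by
  constructor
  · intro z
    rw [hx y]
    exact S.act_rel_right hy z
  · intro z
    rw [S.ract_eq_of_act_eq hy x]
    exact S.ract_rel_left hx z

theorem rel_of_act_rel {x y y' : S.carrier}
    (h : ∀ z, S.act (S.act x y) z = S.act (S.act x y') z) (z : S.carrier) :
    S.act y z = S.act y' z := by
  have h1 : S.ract x y = S.ract x y' := by
    apply S.act_inj (x := S.act x y)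
    rw [S.inv1, h, S.inv1]
  have h2 := S.ract_rel_left (y := S.ract x y) h z
  rw [S.inv2, h1, S.inv2] at h2
  exact h2

theorem rel_of_ract_rel {x x' y : S.carrier}
    (h : ∀ z, S.act (S.ract x y) z = S.act (S.ract x' y) z) (z : S.carrier) :
    S.act x z = S.act x' z := by
  have h1 : S.act x y = S.act x' y := by
    apply S.ract_inj (x := S.ract x y)
    rw [S.inv2, S.ract_eq_of_act_eq h, S.inv2]
  have h2 := S.act_rel_right (x := S.act x y) h z
  rw [S.inv1, h1, S.inv1] at h2
  exact h2

/-- The induced map `r_[X] ([x], [y]) = ([ˣy], [xʸ])` on `[X] = X/∼`. -/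
def retMap : Quotient S.retSetoid × Quotient S.retSetoid →
    Quotient S.retSetoid × Quotient S.retSetoid :=
  fun p => (Quotient.map₂ S.act (fun _ _ hx _ _ hy => (S.r_rel hx hy).1) p.1 p.2,
    Quotient.map₂ S.ract (fun _ _ hx _ _ hy => (S.r_rel hx hy).2) p.1 p.2)

/-- The retraction `Ret(X, r) = ([X], r_[X])`. -/
def ret : SymmetricSet.{u} where
  carrier := Quotient S.retSetoid
  nonempty := S.nonempty.map (Quotient.mk _)
  r := S.retMap
  involutive := by
    rintro ⟨⟨x⟩, ⟨y⟩⟩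
    exact Prod.ext (congrArg (Quotient.mk S.retSetoid) (S.inv1 x y))
      (congrArg (Quotient.mk S.retSetoid) (S.inv2 x y))
  nondegenerate_left := by
    rintro ⟨x⟩
    constructor
    · rintro ⟨y⟩ ⟨y'⟩ h
      have h' : (Quotient.mk S.retSetoid (S.act x y)) = Quotient.mk S.retSetoid (S.act x y') := h
      exact Quotient.sound (s := S.retSetoid) (S.rel_of_act_rel (Quotient.exact h'))
    · rintro ⟨z⟩
      obtain ⟨y, hy⟩ := (S.nondegenerate_left x).2 z
      exact ⟨Quotient.mk _ y, congrArg (Quotient.mk S.retSetoid) hy⟩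
  nondegenerate_right := by
    rintro ⟨y⟩
    constructor
    · rintro ⟨x⟩ ⟨x'⟩ h
      have h' : (Quotient.mk S.retSetoid (S.ract x y)) = Quotient.mk S.retSetoid (S.ract x' y) := h
      exact Quotient.sound (s := S.retSetoid) (S.rel_of_ract_rel (Quotient.exact h'))
    · rintro ⟨z⟩
      obtain ⟨x, hx⟩ := (S.nondegenerate_right y).2 z
      exact ⟨Quotient.mk _ x, congrArg (Quotient.mk S.retSetoid) hx⟩
  braid := by
    rintro ⟨⟨x⟩, ⟨y⟩, ⟨z⟩⟩
    exact congrArg (fun t : S.carrier × S.carrier × S.carrier =>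
      ((Quotient.mk S.retSetoid t.1, Quotient.mk S.retSetoid t.2.1,
        Quotient.mk S.retSetoid t.2.2) :
          Quotient S.retSetoid × Quotient S.retSetoid × Quotient S.retSetoid))
      (S.braid (x, y, z))

/-- `Ret^m(X, r)`. -/
def retIter (S : SymmetricSet.{u}) : ℕ → SymmetricSet.{u}
  | 0 => S
  | m + 1 => (retIter S m).ret

/-- `mpl(X, r) = m`: `m` is the least number such that `Ret^m(X, r)` is a one element set. -/
def HasMpl (m : ℕ) : Prop :=
  IsLeast {k : ℕ | ∃ x : (S.retIter k).carrier, ∀ y, y = x} m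

/-- `(X, r)` is a multipermutation solution, i.e. it has finite multipermutation level. -/
def IsMultipermutation : Prop := ∃ m, S.HasMpl m

/-- `(X, r)` is square-free. -/
def IsSquareFree : Prop := ∀ x, S.r (x, x) = (x, x)

/-- Condition (*): every `x` admits some `a` with `ᵃx = x`. -/
def ConditionStar : Prop := ∀ x : S.carrier, ∃ a : S.carrier, S.act a x = x

end SymmetricSet

/-! ### Symmetric groups in the sense of Takeuchi -/

/-- `(G, σ)` is a braided group: `(G, G, σ)` is a matched pair of groups, where
`σ (a, u) = (ᵃu, aᵘ)`, which satisfies the compatibility condition `uv = (ᵘv)(uᵛ)`. -/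
structure IsBraidedGroup {G : Type u} [Group G] (σ : G × G → G × G) : Prop where
  bijective : Function.Bijective σ
  ml0 : ∀ a u, (σ (a, 1)).1 = 1 ∧ (σ (1, u)).1 = u
  mr0 : ∀ a u, (σ (1, u)).2 = 1 ∧ (σ (a, 1)).2 = a
  ml1 : ∀ a b u, (σ (a * b, u)).1 = (σ (a, (σ (b, u)).1)).1
  mr1 : ∀ a u v, (σ (a, u * v)).2 = (σ ((σ (a, u)).2, v)).2
  ml2 : ∀ a u v, (σ (a, u * v)).1 = (σ (a, u)).1 * (σ ((σ (a, u)).2, v)).1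
  mr2 : ∀ a b u, (σ (a * b, u)).2 = (σ (a, (σ (b, u)).1)).2 * (σ (b, u)).2
  m3 : ∀ u v, u * v = (σ (u, v)).1 * (σ (u, v)).2

/-- A symmetric group in the sense of Takeuchi: a braided group with involutive braiding
operator. -/
structure SymmetricGroup : Type (u + 1) where
  carrier : Type u
  [group : Group carrier]
  σ : carrier × carrier → carrier × carrier
  braided : IsBraidedGroup σ
  involutive : ∀ p, σ (σ p) = p

attribute [instance] SymmetricGroup.group

theorem IsBraidedGroup.left_bijective {G : Type u} [Group G] {σ : G × G → G × G}
    (h : IsBraidedGroup σ) (a : G) : Function.Bijective (fun u => (σ (a, u)).1) := by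
  refine Function.bijective_iff_has_inverse.2 ⟨fun u => (σ (a⁻¹, u)).1, fun u => ?_, fun u => ?_⟩
  · change (σ (a⁻¹, (σ (a, u)).1)).1 = u
    rw [← h.ml1, inv_mul_cancel, (h.ml0 1 u).2]
  · change (σ (a, (σ (a⁻¹, u)).1)).1 = u
    rw [← h.ml1, mul_inv_cancel, (h.ml0 1 u).2]

theorem IsBraidedGroup.right_bijective {G : Type u} [Group G] {σ : G × G → G × G}
    (h : IsBraidedGroup σ) (u : G) : Function.Bijective (fun a => (σ (a, u)).2) := by
  refine Function.bijective_iff_has_inverse.2 ⟨fun a => (σ (a, u⁻¹)).2, fun a => ?_, fun a => ?_⟩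
  · change (σ ((σ (a, u)).2, u⁻¹)).2 = a
    rw [← h.mr1, mul_inv_cancel, (h.mr0 a 1).2]
  · change (σ ((σ (a, u⁻¹)).2, u)).2 = a
    rw [← h.mr1, inv_mul_cancel, (h.mr0 a 1).2]

theorem IsBraidedGroup.braid {G : Type u} [Group G] {σ : G × G → G × G}
    (h : IsBraidedGroup σ) (t : G × G × G) :
    braid12 σ (braid23 σ (braid12 σ t)) = braid23 σ (braid12 σ (braid23 σ t)) := by
  obtain ⟨x, y, z⟩ := t
  have e1 : (braid12 σ (braid23 σ (braid12 σ (x, y, z)))).1 =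
      (braid23 σ (braid12 σ (braid23 σ (x, y, z)))).1 := by
    change (σ ((σ (x, y)).1, (σ ((σ (x, y)).2, z)).1)).1 = (σ (x, (σ (y, z)).1)).1
    rw [← h.ml1, ← h.ml1, ← h.m3]
  have e3 : (braid12 σ (braid23 σ (braid12 σ (x, y, z)))).2.2 =
      (braid23 σ (braid12 σ (braid23 σ (x, y, z)))).2.2 := by
    change (σ ((σ (x, y)).2, z)).2 = (σ ((σ (x, (σ (y, z)).1)).2, (σ (y, z)).2)).2
    rw [← h.mr1, ← h.mr1, ← h.m3]
  have p12 : ∀ s : G × G × G, (braid12 σ s).1 * (braid12 σ s).2.1 * (braid12 σ s).2.2 =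
      s.1 * s.2.1 * s.2.2 := by
    rintro ⟨a, b, c⟩
    exact congrArg (· * c) (h.m3 a b).symm
  have p23 : ∀ s : G × G × G, (braid23 σ s).1 * (braid23 σ s).2.1 * (braid23 σ s).2.2 =
      s.1 * s.2.1 * s.2.2 := by
    rintro ⟨a, b, c⟩
    have := congrArg (a * ·) (h.m3 b c).symm
    simpa [braid23, mul_assoc] using this
  have e := (p12 (braid23 σ (braid12 σ (x, y, z)))).trans
    ((p23 _).trans ((p12 (x, y, z)).trans
      ((p23 (x, y, z)).symm.trans ((p12 _).symm.trans (p23 _).symm))))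
  rw [e1, e3] at e
  exact Prod.ext e1 (Prod.ext (mul_left_cancel (mul_right_cancel e)) e3)

/-- A symmetric group regarded as a non-degenerate symmetric set. -/
def SymmetricGroup.toSymmetricSet (G : SymmetricGroup.{u}) : SymmetricSet.{u} where
  carrier := G.carrier
  nonempty := ⟨1⟩
  r := G.σ
  involutive := G.involutive
  nondegenerate_left := G.braided.left_bijective
  nondegenerate_right := G.braided.right_bijective
  braid := G.braided.braid

/-- The symmetric group structure `σ'` induced on the image of a symmetric group under a surjective
group homomorphism `f` with `σ' ∘ (f × f) = (f × f) ∘ σ`. -/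
def SymmetricGroup.push (G : SymmetricGroup.{u}) {H : Type u} [Group H] (f : G.carrier →* H)
    (hf : Function.Surjective f) (σ' : H × H → H × H)
    (h : ∀ a b, σ' (f a, f b) = (f (G.σ (a, b)).1, f (G.σ (a, b)).2)) : SymmetricGroup.{u} :=
  have inv : ∀ p, σ' (σ' p) = p := by
    rintro ⟨p, q⟩
    obtain ⟨a, rfl⟩ := hf p
    obtain ⟨b, rfl⟩ := hf q
    rw [h, h]
    exact congrArg (fun p : G.carrier × G.carrier => (f p.1, f p.2)) (G.involutive (a, b))
  { carrier := H
    σ := σ'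
    involutive := inv
    braided :=
      { bijective := Function.bijective_iff_has_inverse.2 ⟨σ', inv, inv⟩
        ml0 := by
          intro p q
          obtain ⟨a, rfl⟩ := hf p
          obtain ⟨b, rfl⟩ := hf q
          rw [← map_one f, h, h]
          exact ⟨congrArg f (G.braided.ml0 a b).1, congrArg f (G.braided.ml0 a b).2⟩
        mr0 := by
          intro p q
          obtain ⟨a, rfl⟩ := hf p
          obtain ⟨b, rfl⟩ := hf q
          rw [← map_one f, h, h]
          exact ⟨congrArg f (G.braided.mr0 a b).1, congrArg f (G.braided.mr0 a b).2⟩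
        ml1 := by
          intro p q s
          obtain ⟨a, rfl⟩ := hf p
          obtain ⟨b, rfl⟩ := hf q
          obtain ⟨c, rfl⟩ := hf s
          rw [← map_mul, h, h, h]
          exact congrArg f (G.braided.ml1 a b c)
        mr1 := by
          intro p q s
          obtain ⟨a, rfl⟩ := hf p
          obtain ⟨b, rfl⟩ := hf q
          obtain ⟨c, rfl⟩ := hf s
          rw [← map_mul, h, h, h]
          exact congrArg f (G.braided.mr1 a b c)
        ml2 := by
          intro p q s
          obtain ⟨a, rfl⟩ := hf p
          obtain ⟨b, rfl⟩ := hf q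
          obtain ⟨c, rfl⟩ := hf s
          rw [← map_mul, h, h, h, ← map_mul]
          exact congrArg f (G.braided.ml2 a b c)
        mr2 := by
          intro p q s
          obtain ⟨a, rfl⟩ := hf p
          obtain ⟨b, rfl⟩ := hf q
          obtain ⟨c, rfl⟩ := hf s
          rw [← map_mul, h, h, h, ← map_mul]
          exact congrArg f (G.braided.mr2 a b c)
        m3 := by
          intro p q
          obtain ⟨a, rfl⟩ := hf p
          obtain ⟨b, rfl⟩ := hf q
          rw [h, ← map_mul, ← map_mul]
          exact congrArg f (G.braided.m3 a b) } }

/-! ### The group `G(X, r)` -/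

namespace SymmetricSet

variable (S : SymmetricSet.{u})

/-- The relations `xy = zt`, where `r (x, y) = (z, t)`. (Pairs fixed by `r` only contribute the
trivial relation.) -/
def ybRels : Set (FreeGroup S.carrier) :=
  {w | ∃ x y z t, S.r (x, y) = (z, t) ∧
    w = FreeGroup.of x * FreeGroup.of y * (FreeGroup.of z * FreeGroup.of t)⁻¹}

/-- The underlying group of `G(X, r)`. -/
abbrev YB : Type u := PresentedGroup S.ybRels

/-- The canonical map `X → G(X, r)`. -/
def ι (x : S.carrier) : S.YB := PresentedGroup.of x

theorem ι_mul (x y : S.carrier) : S.ι x * S.ι y = S.ι (S.act x y) * S.ι (S.ract x y) :=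
  PresentedGroup.mk_eq_mk_of_mul_inv_mem (rels := S.ybRels)
    (x := FreeGroup.of x * FreeGroup.of y)
    (y := FreeGroup.of (S.act x y) * FreeGroup.of (S.ract x y))
    ⟨x, y, _, _, rfl, rfl⟩

theorem closure_ι : Subgroup.closure (Set.range S.ι) = ⊤ :=
  PresentedGroup.closure_range_of S.ybRels

/-- A map `X → H` with `f x * f y = f (ˣy) * f (xʸ)` extends to `G(X, r)`. -/
def ybLift {H : Type u} [Group H] (f : S.carrier → H)
    (hf : ∀ x y, f x * f y = f (S.act x y) * f (S.ract x y)) : S.YB →* H :=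
  PresentedGroup.toGroup (f := f) (by
    rintro _ ⟨x, y, z, t, h, rfl⟩
    have hz : S.act x y = z := congrArg Prod.fst h
    have ht : S.ract x y = t := congrArg Prod.snd h
    have := hf x y
    rw [hz, ht] at this
    simp [this])

theorem ybLift_ι {H : Type u} [Group H] (f : S.carrier → H)
    (hf : ∀ x y, f x * f y = f (S.act x y) * f (S.ract x y)) (x : S.carrier) :
    S.ybLift f hf (S.ι x) = f x :=
  PresentedGroup.toGroup.of _

theorem yb_induction {P : S.YB → Prop} (one : P 1) (mul : ∀ g x, P g → P (g * S.ι x))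
    (inv : ∀ g x, P g → P (g * (S.ι x)⁻¹)) (g : S.YB) : P g := by
  have hg : g ∈ Subgroup.closure (Set.range S.ι) := by rw [closure_ι]; trivial
  induction hg using Subgroup.closure_induction_right with
  | one => exact one
  | mul_right g y hy h ih => obtain ⟨x, rfl⟩ := h; exact mul _ _ ih
  | mul_inv_cancel g y hy h ih => obtain ⟨x, rfl⟩ := h; exact inv _ _ ih

/-- The permutation `ℒ_x` of `X`. -/
noncomputable def perm (x : S.carrier) : Equiv.Perm S.carrier :=
  Equiv.ofBijective (S.act x) (S.nondegenerate_left x)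

theorem perm_apply (x y : S.carrier) : S.perm x y = S.act x y := rfl

/-- The canonical left action `ℒ : G(X, r) → Sym(X)`, `x ↦ ℒ_x`. -/
noncomputable def lhom : S.YB →* Equiv.Perm S.carrier :=
  S.ybLift S.perm (fun x y => Equiv.ext fun z => S.l1 x y z)

theorem lhom_ι (x : S.carrier) : S.lhom (S.ι x) = S.perm x := S.ybLift_ι _ _ x

/-- The permutation `v ↦ x + ℒ_x v` of the free abelian group on `X`. -/
noncomputable def affPerm (x : S.carrier) : Equiv.Perm (FreeAbelianGroup S.carrier) where
  toFun v := FreeAbelianGroup.of x + FreeAbelianGroup.map (S.perm x) v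
  invFun v := FreeAbelianGroup.map (S.perm x).symm (v - FreeAbelianGroup.of x)
  left_inv v := by
    dsimp only
    rw [add_sub_cancel_left, ← FreeAbelianGroup.map_comp_apply, Equiv.symm_comp_self,
      FreeAbelianGroup.map_id_apply]
  right_inv v := by
    dsimp only
    rw [← FreeAbelianGroup.map_comp_apply, Equiv.self_comp_symm, FreeAbelianGroup.map_id_apply,
      add_sub_cancel]

theorem map_perm_mul (p q : Equiv.Perm S.carrier) (v : FreeAbelianGroup S.carrier) :
    FreeAbelianGroup.map (p * q : Equiv.Perm S.carrier) v =
      FreeAbelianGroup.map p (FreeAbelianGroup.map q v) := by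
  rw [← FreeAbelianGroup.map_comp_apply]; rfl

theorem map_perm_inv (p : Equiv.Perm S.carrier) (v : FreeAbelianGroup S.carrier) :
    FreeAbelianGroup.map p (FreeAbelianGroup.map (p⁻¹ : Equiv.Perm S.carrier) v) = v := by
  rw [← map_perm_mul, mul_inv_cancel]; exact FreeAbelianGroup.map_id_apply v

/-- The action of `G(X, r)` on the free abelian group on `X` by `x ↦ (v ↦ x + ℒ_x v)`. -/
noncomputable def aff : S.YB →* Equiv.Perm (FreeAbelianGroup S.carrier) :=
  S.ybLift S.affPerm (by
    intro x y
    ext v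
    have h : S.perm x * S.perm y = S.perm (S.act x y) * S.perm (S.ract x y) :=
      Equiv.ext fun z => S.l1 x y z
    change FreeAbelianGroup.of x + FreeAbelianGroup.map (S.perm x)
        (FreeAbelianGroup.of y + FreeAbelianGroup.map (S.perm y) v) =
      FreeAbelianGroup.of (S.act x y) + FreeAbelianGroup.map (S.perm (S.act x y))
        (FreeAbelianGroup.of (S.ract x y) + FreeAbelianGroup.map (S.perm (S.ract x y)) v)
    rw [map_add, map_add, ← map_perm_mul, ← map_perm_mul, h, FreeAbelianGroup.map_of_apply,
      FreeAbelianGroup.map_of_apply, perm_apply, perm_apply, S.inv1, add_left_comm])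

/-- The bijective 1-cocycle from `G(X, r)` to the free abelian group on `X`, which is the identity
on `X`. -/
noncomputable def cocycle (g : S.YB) : FreeAbelianGroup S.carrier := S.aff g 0

theorem aff_ι (x : S.carrier) (v : FreeAbelianGroup S.carrier) :
    S.aff (S.ι x) v = FreeAbelianGroup.of x + FreeAbelianGroup.map (S.perm x) v := by
  rw [aff, ybLift_ι]; rfl

theorem aff_apply (g : S.YB) : ∀ v, S.aff g v = S.cocycle g +
    FreeAbelianGroup.map (S.lhom g) v := by
  have hmul : ∀ g h : S.YB, (∀ v, S.aff g v = S.cocycle g + FreeAbelianGroup.map (S.lhom g) v) →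
      (∀ v, S.aff h v = S.cocycle h + FreeAbelianGroup.map (S.lhom h) v) →
      ∀ v, S.aff (g * h) v = S.cocycle (g * h) + FreeAbelianGroup.map (S.lhom (g * h)) v := by
    intro g h hg hh v
    have e1 : S.cocycle (g * h) = S.cocycle g + FreeAbelianGroup.map (S.lhom g) (S.cocycle h) := by
      rw [← hg, cocycle, map_mul]; rfl
    rw [e1, map_mul, map_mul, Equiv.Perm.mul_apply, hg, hh v, map_add, map_perm_mul, add_assoc]
  have hι : ∀ x v, S.aff (S.ι x) v = S.cocycle (S.ι x) +
      FreeAbelianGroup.map (S.lhom (S.ι x)) v := by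
    intro x v
    rw [cocycle, aff_ι, aff_ι, map_zero, add_zero, lhom_ι]
  have hinv : ∀ x v, S.aff (S.ι x)⁻¹ v = S.cocycle (S.ι x)⁻¹ +
      FreeAbelianGroup.map (S.lhom (S.ι x)⁻¹) v := by
    intro x v
    apply (S.aff (S.ι x)).injective
    rw [← Equiv.Perm.mul_apply, ← map_mul, mul_inv_cancel, hι, map_add, map_inv S.lhom,
      map_perm_inv, ← add_assoc, ← hι, cocycle, ← Equiv.Perm.mul_apply, ← map_mul, mul_inv_cancel]
    simp
  induction g using S.yb_induction with
  | one =>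
    intro v
    simp only [cocycle, map_one, Equiv.Perm.one_apply, zero_add]
    exact (FreeAbelianGroup.map_id_apply v).symm
  | mul g x ih => exact hmul _ _ ih (hι x)
  | inv g x ih => exact hmul _ _ ih (hinv x)

theorem cocycle_one : S.cocycle 1 = 0 := by simp [cocycle]

theorem cocycle_mul (g h : S.YB) : S.cocycle (g * h) =
    S.cocycle g + FreeAbelianGroup.map (S.lhom g) (S.cocycle h) := by
  rw [← aff_apply, cocycle, map_mul]; rfl

theorem cocycle_ι (x : S.carrier) : S.cocycle (S.ι x) = FreeAbelianGroup.of x := by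
  rw [cocycle, aff_ι, map_zero, add_zero]

theorem cocycle_mul_ι (g : S.YB) (x : S.carrier) : S.cocycle (g * S.ι x) =
    S.cocycle g + FreeAbelianGroup.of (S.lhom g x) := by
  rw [cocycle_mul, cocycle_ι, FreeAbelianGroup.map_of_apply]

theorem perm_apply_inv_self {X : Type u} (p : Equiv.Perm X) (x : X) : p (p⁻¹ x) = x :=
  Equiv.apply_symm_apply p x

theorem perm_inv_apply_self {X : Type u} (p : Equiv.Perm X) (x : X) : p⁻¹ (p x) = x :=
  Equiv.symm_apply_apply p x

/-- The element `z` with `ᶻy = z`. -/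
noncomputable def diag (y : S.carrier) : S.carrier := (S.exists_act_eq y).choose

theorem act_diag (y : S.carrier) : S.act (S.diag y) y = S.diag y := (S.exists_act_eq y).choose_spec

/-- The permutation `g ↦ x + g` of `G(X, r)`. -/
noncomputable def trans (x : S.carrier) : Equiv.Perm S.YB where
  toFun g := g * S.ι ((S.lhom g)⁻¹ x)
  invFun g := g * (S.ι (S.diag ((S.lhom g)⁻¹ x)))⁻¹
  left_inv g := by
    have h : S.diag ((S.lhom (g * S.ι ((S.lhom g)⁻¹ x)))⁻¹ x) = (S.lhom g)⁻¹ x := by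
      apply S.act_eq_unique (S.act_diag _)
      rw [map_mul, lhom_ι, mul_inv_rev, Equiv.Perm.mul_apply, ← perm_apply,
        perm_apply_inv_self]
    simp only [h, mul_inv_cancel_right]
  right_inv g := by
    have h : (S.lhom (g * (S.ι (S.diag ((S.lhom g)⁻¹ x)))⁻¹))⁻¹ x =
        S.diag ((S.lhom g)⁻¹ x) := by
      rw [map_mul, map_inv, lhom_ι, mul_inv_rev, inv_inv, Equiv.Perm.mul_apply, perm_apply,
        act_diag]
    simp only [h, inv_mul_cancel_right]

theorem trans_apply (x : S.carrier) (g : S.YB) :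
    S.trans x g = g * S.ι ((S.lhom g)⁻¹ x) := rfl

theorem trans_lhom (g : S.YB) (x : S.carrier) : S.trans (S.lhom g x) g = g * S.ι x := by
  rw [trans_apply, perm_inv_apply_self]

theorem ι_mul_symm (x y : S.carrier) :
    S.ι x * S.ι ((S.perm x)⁻¹ y) = S.ι y * S.ι ((S.perm y)⁻¹ x) := by
  have h : S.act x ((S.perm x)⁻¹ y) = y := by
    rw [← perm_apply, perm_apply_inv_self]
  have h2 : S.ract x ((S.perm x)⁻¹ y) = (S.perm y)⁻¹ x := by
    rw [Equiv.Perm.eq_inv_iff_eq, perm_apply]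
    have := S.inv1 x ((S.perm x)⁻¹ y)
    rwa [h] at this
  rw [ι_mul, h, h2]

theorem trans_comm (x y : S.carrier) : S.trans x * S.trans y = S.trans y * S.trans x := by
  ext g
  simp only [Equiv.Perm.mul_apply, trans_apply, map_mul, lhom_ι, mul_inv_rev, mul_assoc]
  rw [ι_mul_symm]

theorem cocycle_injective : Function.Injective S.cocycle := by
  have hc : ∀ a ∈ Set.range S.trans, ∀ b ∈ Set.range S.trans, a * b = b * a := by
    rintro _ ⟨x, rfl⟩ _ ⟨y, rfl⟩
    exact S.trans_comm x y
  let C := Subgroup.closure (Set.range S.trans)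
  have hC : IsMulCommutative C := Subgroup.isMulCommutative_closure hc
  let _ : CommGroup C := { (inferInstance : Group C) with mul_comm := hC.is_comm.comm }
  let θ : FreeAbelianGroup S.carrier →+ Additive C :=
    FreeAbelianGroup.lift fun x => Additive.ofMul
      (⟨S.trans x, Subgroup.subset_closure ⟨x, rfl⟩⟩ : C)
  let ev : FreeAbelianGroup S.carrier → Equiv.Perm S.YB := fun v => ((θ v).toMul : C)
  have ev_add : ∀ v w, ev (v + w) = ev v * ev w := fun v w => by simp only [ev, map_add]; rfl
  have ev_comm : ∀ v w, ev (v + w) = ev w * ev v := fun v w => by rw [add_comm, ev_add]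
  have ev_of : ∀ x, ev (FreeAbelianGroup.of x) = S.trans x := fun x => by
    simp only [ev, θ, FreeAbelianGroup.lift_apply_of]; rfl
  have key : ∀ g, ev (S.cocycle g) 1 = g := by
    intro g
    induction g using S.yb_induction with
    | one => rw [cocycle_one]; simp only [ev, map_zero]; rfl
    | mul g x ih =>
      rw [cocycle_mul_ι, ev_comm, Equiv.Perm.mul_apply, ih, ev_of, trans_lhom]
    | inv g x ih =>
      apply (S.trans (S.lhom (g * (S.ι x)⁻¹) x)).injective
      rw [trans_lhom, ← ev_of, ← Equiv.Perm.mul_apply, ← ev_comm, ← cocycle_mul_ι,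
        inv_mul_cancel_right, ih]
  intro g h e
  rw [← key g, ← key h, e]

theorem cocycle_surjective : Function.Surjective S.cocycle := by
  have key : ∀ v : FreeAbelianGroup S.carrier, ∀ g, ∃ g', S.cocycle g' = S.cocycle g + v := by
    intro v
    induction v using FreeAbelianGroup.induction_on with
    | zero => exact fun g => ⟨g, (add_zero _).symm⟩
    | of x =>
      intro g
      exact ⟨S.trans x g, by rw [trans_apply, cocycle_mul_ι, perm_apply_inv_self]⟩
    | neg x _ =>
      intro g
      refine ⟨(S.trans x).symm g, ?_⟩
      rw [eq_add_neg_iff_add_eq]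
      conv_rhs => rw [← (S.trans x).apply_symm_apply g]
      rw [trans_apply, cocycle_mul_ι, perm_apply_inv_self]
    | add v w hv hw =>
      intro g
      obtain ⟨g1, h1⟩ := hv g
      obtain ⟨g2, h2⟩ := hw g1
      exact ⟨g2, by rw [h2, h1, add_assoc]⟩
  intro v
  obtain ⟨g, hg⟩ := key v 1
  exact ⟨g, by rw [hg, cocycle_one, zero_add]⟩

/-- The left action `ᵃb` of `G(X, r)` upon itself: the action of `G(X, r)` on the free abelian group
on `X`, transported along the bijective cocycle. -/
noncomputable def gact (a b : S.YB) : S.YB :=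
  (Equiv.ofBijective S.cocycle ⟨S.cocycle_injective, S.cocycle_surjective⟩).symm
    (FreeAbelianGroup.map (S.lhom a) (S.cocycle b))

theorem cocycle_gact (a b : S.YB) :
    S.cocycle (S.gact a b) = FreeAbelianGroup.map (S.lhom a) (S.cocycle b) :=
  (Equiv.ofBijective S.cocycle ⟨S.cocycle_injective, S.cocycle_surjective⟩).apply_symm_apply _

/-- The braiding operator `r_G (a, b) = (ᵃb, aᵇ)` on `G(X, r)`, where `aᵇ = (ᵃb)⁻¹ab`. It is
characterized below as the only braiding operator on `G(X, r)` which extends `r`. -/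
noncomputable def ybσ (p : S.YB × S.YB) : S.YB × S.YB :=
  (S.gact p.1 p.2, (S.gact p.1 p.2)⁻¹ * p.1 * p.2)

theorem gact_ι (a : S.YB) (x : S.carrier) : S.gact a (S.ι x) = S.ι (S.lhom a x) := by
  apply S.cocycle_injective
  rw [cocycle_gact, cocycle_ι, cocycle_ι, FreeAbelianGroup.map_of_apply]

/-- `r_G` extends `r`: `r_G ∘ (ι × ι) = (ι × ι) ∘ r`. -/
theorem ybσ_ι (x y : S.carrier) :
    S.ybσ (S.ι x, S.ι y) = (S.ι (S.r (x, y)).1, S.ι (S.r (x, y)).2) := by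
  have h : S.gact (S.ι x) (S.ι y) = S.ι (S.act x y) := by
    rw [gact_ι, lhom_ι, perm_apply]
  refine Prod.ext h ?_
  change (S.gact (S.ι x) (S.ι y))⁻¹ * S.ι x * S.ι y = S.ι (S.ract x y)
  rw [h, mul_assoc, ι_mul, inv_mul_cancel_left]

theorem gact_mul_left (a b c : S.YB) : S.gact (a * b) c = S.gact a (S.gact b c) := by
  apply S.cocycle_injective
  rw [cocycle_gact, cocycle_gact, cocycle_gact, map_mul, map_perm_mul]

theorem gact_one (a : S.YB) : S.gact a 1 = 1 := by
  apply S.cocycle_injective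
  rw [cocycle_gact, cocycle_one, map_zero]

theorem one_gact (a : S.YB) : S.gact 1 a = a := by
  apply S.cocycle_injective
  rw [cocycle_gact, map_one]; exact FreeAbelianGroup.map_id_apply _

theorem gact_mul (a b c : S.YB) :
    S.gact a (b * c) = S.gact a b * S.gact ((S.gact a b)⁻¹ * a * b) c := by
  apply S.cocycle_injective
  have e : S.gact a b * ((S.gact a b)⁻¹ * a * b) = a * b := by group
  rw [cocycle_gact, cocycle_mul, cocycle_mul, cocycle_gact, cocycle_gact, map_add,
    ← map_perm_mul, ← map_perm_mul, ← map_mul, ← map_mul, e]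

theorem gact_gact (a b : S.YB) : S.gact (S.gact a b) ((S.gact a b)⁻¹ * a * b) = a := by
  apply S.cocycle_injective
  have h1 := S.cocycle_mul (S.gact a b) ((S.gact a b)⁻¹ * a * b)
  rw [mul_assoc, mul_inv_cancel_left, cocycle_mul, cocycle_gact, add_comm] at h1
  rw [cocycle_gact, mul_assoc]
  exact (add_left_cancel h1).symm

theorem ybσ_involutive (p : S.YB × S.YB) : S.ybσ (S.ybσ p) = p := by
  obtain ⟨a, b⟩ := p
  refine Prod.ext (S.gact_gact a b) ?_
  change (S.gact (S.gact a b) ((S.gact a b)⁻¹ * a * b))⁻¹ * S.gact a b *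
    ((S.gact a b)⁻¹ * a * b) = b
  rw [gact_gact]
  group

theorem ybσ_braided : IsBraidedGroup S.ybσ where
  bijective := Function.bijective_iff_has_inverse.2
    ⟨S.ybσ, S.ybσ_involutive, S.ybσ_involutive⟩
  ml0 a u := ⟨S.gact_one a, S.one_gact u⟩
  mr0 a u := by simp [ybσ, gact_one, one_gact]
  ml1 := S.gact_mul_left
  mr1 a u v := by
    simp only [ybσ]
    rw [gact_mul]
    group
  ml2 := S.gact_mul
  mr2 a b u := by
    simp only [ybσ]
    rw [gact_mul_left]
    group
  m3 u v := by
    simp only [ybσ]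
    group

/-- The symmetric group `(G, r_G)` associated to `(X, r)`, where `G = G(X, r)`. -/
noncomputable def ybGroup : SymmetricGroup.{u} where
  carrier := S.YB
  σ := S.ybσ
  braided := S.ybσ_braided
  involutive := S.ybσ_involutive

/-- `r_G` is the only braiding operator on `G(X, r)` which extends `r`. -/
theorem ybσ_unique {σ : S.YB × S.YB → S.YB × S.YB} (hσ : IsBraidedGroup σ)
    (h : ∀ x y, σ (S.ι x, S.ι y) = (S.ι (S.r (x, y)).1, S.ι (S.r (x, y)).2)) : σ = S.ybσ := by
  have hτ := S.ybσ_braided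
  have h' := S.ybσ_ι
  generalize S.ybσ = τ at hτ h' ⊢
  have mulP : ∀ a b, (∀ x, σ (a, S.ι x) = τ (a, S.ι x) ∧ ∃ y, (σ (a, S.ι x)).1 = S.ι y) →
      (∀ x, σ (b, S.ι x) = τ (b, S.ι x) ∧ ∃ y, (σ (b, S.ι x)).1 = S.ι y) →
      ∀ x, σ (a * b, S.ι x) = τ (a * b, S.ι x) ∧ ∃ y, (σ (a * b, S.ι x)).1 = S.ι y := by
    intro a b ha hb x
    obtain ⟨e, y, hy⟩ := hb x
    obtain ⟨e', z, hz⟩ := ha y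
    refine ⟨Prod.ext ?_ ?_, z, ?_⟩
    · rw [hσ.ml1, hτ.ml1, ← e, hy, e']
    · rw [hσ.mr2, hτ.mr2, ← e, hy, e']
    · rw [hσ.ml1, hy, hz]
  have P : ∀ a x, σ (a, S.ι x) = τ (a, S.ι x) ∧ ∃ y, (σ (a, S.ι x)).1 = S.ι y := by
    intro a
    induction a using S.yb_induction with
    | one =>
      intro x
      refine ⟨Prod.ext ?_ ?_, x, (hσ.ml0 1 _).2⟩
      · rw [(hσ.ml0 1 _).2, (hτ.ml0 1 _).2]
      · rw [(hσ.mr0 1 _).1, (hτ.mr0 1 _).1]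
    | mul a y ih =>
      refine mulP _ _ ih fun x => ⟨by rw [h, h'], _, by rw [h]⟩
    | inv a y ih =>
      refine mulP _ _ ih fun x => ?_
      obtain ⟨w, hw⟩ := (S.nondegenerate_left y).2 x
      have aux : ∀ ρ : S.YB × S.YB → S.YB × S.YB, IsBraidedGroup ρ →
          (∀ x y, ρ (S.ι x, S.ι y) = (S.ι (S.r (x, y)).1, S.ι (S.r (x, y)).2)) →
          ρ ((S.ι y)⁻¹, S.ι x) = (S.ι w, (S.ι (S.r (y, w)).2)⁻¹) := by
        intro ρ hρ hρ'
        have e : (ρ (S.ι y, S.ι w)).1 = S.ι x := by rw [hρ']; exact congrArg S.ι hw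
        refine Prod.ext ?_ ?_
        · rw [← e, ← hρ.ml1, inv_mul_cancel, (hρ.ml0 1 _).2]
        · have := hρ.mr2 (S.ι y)⁻¹ (S.ι y) (S.ι w)
          rw [inv_mul_cancel, (hρ.mr0 1 _).1, e, hρ'] at this
          exact eq_inv_of_mul_eq_one_left this.symm
      exact ⟨by rw [aux σ hσ h, aux τ hτ h'], w, by rw [aux σ hσ h]⟩
  have mulQ : ∀ u v, (∀ a, σ (a, u) = τ (a, u)) → (∀ a, σ (a, v) = τ (a, v)) →
      ∀ a, σ (a, u * v) = τ (a, u * v) := by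
    intro u v hu hv a
    refine Prod.ext ?_ ?_
    · rw [hσ.ml2, hτ.ml2, hu, hv]
    · rw [hσ.mr1, hτ.mr1, hu, hv]
  have invQ : ∀ u, (∀ a, σ (a, u) = τ (a, u)) → ∀ a, σ (a, u⁻¹) = τ (a, u⁻¹) := by
    intro u hu a
    have e : (σ (a, u⁻¹)).2 = (τ (a, u⁻¹)).2 := by
      apply (hσ.right_bijective u).1
      change (σ ((σ (a, u⁻¹)).2, u)).2 = (σ ((τ (a, u⁻¹)).2, u)).2
      rw [← hσ.mr1, hu, ← hτ.mr1, inv_mul_cancel, (hσ.mr0 a 1).2, (hτ.mr0 a 1).2]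
    refine Prod.ext ?_ e
    have e1 := hσ.ml2 a u⁻¹ u
    have e2 := hτ.ml2 a u⁻¹ u
    rw [inv_mul_cancel, (hσ.ml0 a 1).1, e, hu] at e1
    rw [inv_mul_cancel, (hτ.ml0 a 1).1] at e2
    exact mul_right_cancel (e1.symm.trans e2)
  have Q : ∀ u a, σ (a, u) = τ (a, u) := by
    intro u
    induction u using S.yb_induction with
    | one =>
      intro a
      refine Prod.ext ?_ ?_
      · rw [(hσ.ml0 a 1).1, (hτ.ml0 a 1).1]
      · rw [(hσ.mr0 a 1).2, (hτ.mr0 a 1).2]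
    | mul u x ih => exact mulQ _ _ ih fun a => (P a x).1
    | inv u x ih => exact mulQ _ _ ih (invQ _ fun a => (P a x).1)
  funext p
  exact Q p.2 p.1

/-! ### The permutation group `𝒢(X, r)` -/

theorem lhom_gact_eq {a a' b b' : S.YB} (ha : S.lhom a = S.lhom a') (hb : S.lhom b = S.lhom b') :
    S.lhom (S.gact a b) = S.lhom (S.gact a' b') := by
  have hker : ∀ c k : S.YB, S.lhom k = 1 → S.lhom (S.gact c k) = 1 := by
    intro c k hk
    have h2 : S.gact c k = c * k * c⁻¹ := by
      have hk' : S.lhom (c * k * c⁻¹) = 1 := by simp [hk]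
      have hkc' : S.gact (c * k * c⁻¹) c = c := by
        apply S.cocycle_injective
        rw [cocycle_gact, hk']; exact FreeAbelianGroup.map_id_apply _
      have h3 := S.gact_gact (c * k * c⁻¹) c
      rw [hkc'] at h3
      have h4 : c⁻¹ * (c * k * c⁻¹) * c = k := by group
      rwa [h4] at h3
    simp [h2, hk]
  have e1 : S.gact a b' = S.gact a' b' := by
    apply S.cocycle_injective
    rw [cocycle_gact, cocycle_gact, ha]
  rw [← e1]
  have h := S.gact_mul a b (b⁻¹ * b')
  rw [mul_inv_cancel_left] at h
  rw [h, map_mul, hker _ (b⁻¹ * b') (by simp [hb]), mul_one]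

/-- The underlying group of `𝒢(X, r)`: the image of `ℒ : G(X, r) → Sym(X)`. -/
noncomputable abbrev PermG : Subgroup (Equiv.Perm S.carrier) := S.lhom.range

/-- The epimorphism `G(X, r) → 𝒢(X, r)` induced by `ℒ`. -/
noncomputable def toPermG : S.YB →* S.PermG := S.lhom.rangeRestrict

theorem toPermG_surjective : Function.Surjective S.toPermG := S.lhom.rangeRestrict_surjective

/-- The braiding operator `r_𝒢 (ℒ_a, ℒ_b) = (ℒ_{ᵃb}, ℒ_{aᵇ})` on `𝒢(X, r)`, i.e. the one of the
quotient of `(G, r_G)` by the kernel of `ℒ`. -/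
noncomputable def permσ (p : S.PermG × S.PermG) : S.PermG × S.PermG :=
  let a := (S.toPermG_surjective p.1).choose
  let b := (S.toPermG_surjective p.2).choose
  (S.toPermG (S.ybσ (a, b)).1, S.toPermG (S.ybσ (a, b)).2)

theorem permσ_apply (a b : S.YB) : S.permσ (S.toPermG a, S.toPermG b) =
    (S.toPermG (S.ybσ (a, b)).1, S.toPermG (S.ybσ (a, b)).2) := by
  have ha := (S.toPermG_surjective (S.toPermG a)).choose_spec
  have hb := (S.toPermG_surjective (S.toPermG b)).choose_spec
  have h : S.toPermG (S.gact (S.toPermG_surjective (S.toPermG a)).choose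
      (S.toPermG_surjective (S.toPermG b)).choose) = S.toPermG (S.gact a b) :=
    Subtype.ext (S.lhom_gact_eq (congrArg Subtype.val ha) (congrArg Subtype.val hb))
  refine Prod.ext h ?_
  simp only [permσ, ybσ, map_mul, map_inv, h, ha, hb]

/-- The symmetric group `(𝒢, r_𝒢)`, where `𝒢 = 𝒢(X, r)`. -/
noncomputable def permGroup : SymmetricGroup.{u} :=
  S.ybGroup.push (H := S.PermG) S.toPermG S.toPermG_surjective S.permσ S.permσ_apply

end SymmetricSet

/-! Equality of images in `Ret^k` is pulled back to a relation `~_k` on the original set, and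
`retRel_succ` gives the recursion `x ~_{k+1} y` iff `ˣz ~_k ʸz` for all `z`. Only the left action
enters, and every claim about levels becomes a claim about when `~_k` is total.

The bijective cocycle carries the addition of the free abelian group on `X` over to `G`, and `G`
acts on itself by automorphisms of this addition, permuting the generators as `ℒ` permutes `X`. Each
`~_k` on `G` is an additive congruence (`YBRel.ybAdd`), so `a ~_{k+1} b` can be tested on generators
(`ybRel_succ_of_ι`), and `~_k` on `G` restricts to `~_k` on `X` (`ybRel_ι_iff`). Hence triviality of
`Ret^k(G)` gives that of `Ret^k(X)`, which in turn gives that of `Ret^{k+1}(G)`.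

An element of `G` acts trivially on `X` exactly when it acts trivially on `G`, so `𝒢` is `Ret(G)`
and its level is one lower (`retTrivial_permGroup_iff`). Under condition (*), triviality of
`Ret^{k+1}(X)` forces every `ℒ_x` to act trivially on `Ret^k(X)`. Then so does all of `G`, and the
levels of `X` and `G` coincide. -/

namespace SymmetricSet

/-! ### Iterated retractions as relations on the original set -/

section RetractionTower

variable (S : SymmetricSet.{u})

/-- The canonical projection `X → Ret^k(X, r)`. -/
def retProj : ∀ k : ℕ, S.carrier → (S.retIter k).carrier
  | 0 => id
  | k + 1 => fun x => Quotient.mk (S.retIter k).retSetoid (retProj k x)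

theorem retProj_surjective (k : ℕ) : Function.Surjective (S.retProj k) := by
  induction k with
  | zero => exact Function.surjective_id
  | succ k ih => exact Quotient.mk_surjective.comp ih

theorem retProj_act (k : ℕ) (x y : S.carrier) :
    S.retProj k (S.act x y) = (S.retIter k).act (S.retProj k x) (S.retProj k y) := by
  induction k with
  | zero => rfl
  | succ k ih => exact congrArg (Quotient.mk (S.retIter k).retSetoid) ih

/-- `x` and `y` have the same image in `Ret^k(X, r)`. -/
def RetRel (k : ℕ) (x y : S.carrier) : Prop := S.retProj k x = S.retProj k y

variable {S}

/-- The projection to `Ret^k` is surjective and respects the action, so the quantifier over `Ret^k`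
can be pulled back. This removes iterated quotients from all later arguments. -/
theorem retRel_succ {k : ℕ} {x y : S.carrier} :
    S.RetRel (k + 1) x y ↔ ∀ z, S.RetRel k (S.act x z) (S.act y z) := by
  have h : S.RetRel (k + 1) x y ↔
      ∀ z, (S.retIter k).act (S.retProj k x) z = (S.retIter k).act (S.retProj k y) z :=
    Quotient.eq (r := (S.retIter k).retSetoid)
  rw [h, (S.retProj_surjective k).forall]
  simp only [RetRel, retProj_act]

theorem RetRel.act {k : ℕ} {x x' y y' : S.carrier} (hx : S.RetRel k x x')
    (hy : S.RetRel k y y') : S.RetRel k (S.act x y) (S.act x' y') := by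
  rw [RetRel, retProj_act, retProj_act, hx, hy]

theorem RetRel.of_act {k : ℕ} {x x' y y' : S.carrier} (hx : S.RetRel k x x')
    (h : S.RetRel k (S.act x y) (S.act x' y')) : S.RetRel k y y' := by
  rw [RetRel, retProj_act, retProj_act, hx] at h
  exact (S.retIter k).act_inj h

variable (S) in
/-- `Ret^k(X, r)` has exactly one element. -/
def RetTrivial (k : ℕ) : Prop := ∀ x y, S.RetRel k x y

theorem retTrivial_iff {k : ℕ} :
    S.RetTrivial k ↔ ∃ x : (S.retIter k).carrier, ∀ y, y = x := by
  constructor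
  · intro h
    obtain ⟨x⟩ := S.nonempty
    exact ⟨S.retProj k x, (S.retProj_surjective k).forall.2 fun y => h y x⟩
  · rintro ⟨x, hx⟩ y z
    exact (hx _).trans (hx _).symm

theorem hasMpl_iff {m : ℕ} : S.HasMpl m ↔ IsLeast {k | S.RetTrivial k} m := by
  simp only [HasMpl, retTrivial_iff]

theorem isMultipermutation_iff : S.IsMultipermutation ↔ ∃ k, S.RetTrivial k := by
  classical
  simp only [IsMultipermutation, hasMpl_iff]
  exact ⟨fun ⟨m, h⟩ => ⟨m, h.1⟩, fun h => ⟨Nat.find h, Nat.isLeast_find h⟩⟩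

end RetractionTower

/-! ### The tower of retractions of `G(X, r)` -/

section YBGroup

variable {S : SymmetricSet.{u}}

theorem ι_injective : Function.Injective S.ι := fun x y h => by
  have h' := congrArg S.cocycle h
  rw [cocycle_ι, cocycle_ι] at h'
  exact FreeAbelianGroup.of_injective h'

theorem gact_ι_ι (x y : S.carrier) : S.gact (S.ι x) (S.ι y) = S.ι (S.act x y) := by
  rw [gact_ι, lhom_ι, perm_apply]

/-- `a` and `b` have the same image in `Ret^k(G, r_G)`. -/
def YBRel (k : ℕ) (a b : S.YB) : Prop := S.ybGroup.toSymmetricSet.RetRel k a b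

theorem ybRel_zero {a b : S.YB} : YBRel 0 a b ↔ a = b := Iff.rfl

theorem ybRel_succ {k : ℕ} {a b : S.YB} :
    YBRel (k + 1) a b ↔ ∀ c, YBRel k (S.gact a c) (S.gact b c) := retRel_succ

theorem YBRel.gact {k : ℕ} {a a' b b' : S.YB} (ha : YBRel k a a') (hb : YBRel k b b') :
    YBRel k (S.gact a b) (S.gact a' b') := RetRel.act ha hb

theorem YBRel.of_gact {k : ℕ} {a a' b b' : S.YB} (ha : YBRel k a a')
    (h : YBRel k (S.gact a b) (S.gact a' b')) : YBRel k b b' := RetRel.of_act ha h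

theorem gact_gact_inv (a b : S.YB) : S.gact a (S.gact a⁻¹ b) = b := by
  rw [← gact_mul_left, mul_inv_cancel, one_gact]

/-! ### Additive structure and reduction to generators -/

/-- The sum on `G(X, r)` transported from the free abelian group along the bijective cocycle. -/
noncomputable def ybAdd (a b : S.YB) : S.YB := a * S.gact a⁻¹ b

theorem cocycle_ybAdd (a b : S.YB) :
    S.cocycle (ybAdd a b) = S.cocycle a + S.cocycle b := by
  rw [ybAdd, cocycle_mul, ← cocycle_gact, gact_gact_inv]

theorem gact_ybAdd (a b c : S.YB) : S.gact a (ybAdd b c) = ybAdd (S.gact a b) (S.gact a c) := by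
  apply S.cocycle_injective
  simp only [cocycle_gact, cocycle_ybAdd, map_add]

/-- `Ret^k(G, r_G)` is a quotient of the additive group of `G(X, r)`. -/
theorem YBRel.ybAdd {k : ℕ} {a a' b b' : S.YB} (ha : YBRel k a a') (hb : YBRel k b b') :
    YBRel k (ybAdd a b) (ybAdd a' b') := by
  cases k with
  | zero =>
    rw [ybRel_zero] at ha hb
    subst ha hb
    rfl
  | succ k =>
    -- Acting by the related elements `a` and `a'` gives back `b` and `b'`, so left cancellation in
    -- `Ret^{k+1}(G)` applies.
    have hd : YBRel (k + 1) (S.gact a⁻¹ b) (S.gact a'⁻¹ b') := by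
      apply YBRel.of_gact ha
      rwa [gact_gact_inv, gact_gact_inv]
    rw [ybRel_succ]
    intro c
    rw [SymmetricSet.ybAdd, SymmetricSet.ybAdd, gact_mul_left, gact_mul_left]
    -- Replace the outer actor `a` by `a'`, then the inner one. No induction on `k` is needed.
    exact (ybRel_succ.1 ha _).trans (YBRel.gact (a := a') rfl (ybRel_succ.1 hd c))

/-- Adding `a' + b'` to both sides of the relation between `a` and `b` cancels `a` against `a'` on
one side and `b` against `b'` on the other, leaving `b'` and `a'`. -/
theorem YBRel.of_cocycle_neg {k : ℕ} {a a' b b' : S.YB} (h : YBRel k a b)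
    (ha : S.cocycle a' = -S.cocycle a) (hb : S.cocycle b' = -S.cocycle b) : YBRel k a' b' := by
  have h1 := YBRel.ybAdd h (rfl : YBRel k (SymmetricSet.ybAdd a' b') _)
  have e1 : SymmetricSet.ybAdd a (SymmetricSet.ybAdd a' b') = b' := by
    apply S.cocycle_injective
    rw [cocycle_ybAdd, cocycle_ybAdd, ha, add_neg_cancel_left]
  have e2 : SymmetricSet.ybAdd b (SymmetricSet.ybAdd a' b') = a' := by
    apply S.cocycle_injective
    rw [cocycle_ybAdd, cocycle_ybAdd, hb]
    abel
  rw [e1, e2] at h1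
  exact h1.symm

/-- Whether `a` and `b` agree in `Ret^{k+1}(G, r_G)` can be tested on the generators. -/
theorem ybRel_succ_of_ι {k : ℕ} {a b : S.YB}
    (h : ∀ x, YBRel k (S.gact a (S.ι x)) (S.gact b (S.ι x))) : YBRel (k + 1) a b := by
  rw [ybRel_succ]
  -- The elements `c` on which `a` and `b` agree modulo `~_k` are closed under the additive
  -- operations. Inducting on the cocycle value makes the additive induction principle available.
  suffices H : ∀ v c, S.cocycle c = v → YBRel k (S.gact a c) (S.gact b c) from
    fun c => H _ c rfl
  intro v
  induction v using FreeAbelianGroup.induction_on with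
  | zero =>
    intro c hc
    rw [S.cocycle_injective (hc.trans S.cocycle_one.symm), gact_one, gact_one]
    rfl
  | of x =>
    intro c hc
    rw [S.cocycle_injective (hc.trans (S.cocycle_ι x).symm)]
    exact h x
  | neg x _ =>
    intro c hc
    refine (h x).of_cocycle_neg ?_ ?_ <;>
      rw [cocycle_gact, cocycle_gact, hc, cocycle_ι, map_neg]
  | add v w hv hw =>
    intro c hc
    obtain ⟨d, rfl⟩ := S.cocycle_surjective v
    obtain ⟨e, rfl⟩ := S.cocycle_surjective w
    rw [S.cocycle_injective (hc.trans (cocycle_ybAdd d e).symm), gact_ybAdd, gact_ybAdd]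
    exact (hv d rfl).ybAdd (hw e rfl)

/-- The bridge between the towers of `X` and `G`. Passing from `X` to `G` is the substantial
direction: agreement on generators must imply agreement on all of `G`. -/
theorem ybRel_ι_iff {k : ℕ} {x y : S.carrier} :
    YBRel k (S.ι x) (S.ι y) ↔ S.RetRel k x y := by
  induction k generalizing x y with
  | zero => exact ι_injective.eq_iff
  | succ k ih =>
    constructor
    · intro h
      rw [retRel_succ]
      intro z
      rw [← ih, ← gact_ι_ι, ← gact_ι_ι]
      exact ybRel_succ.1 h _
    · intro h
      apply ybRel_succ_of_ι
      intro z
      rw [gact_ι_ι, gact_ι_ι, ih]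
      exact retRel_succ.1 h z

/-! ### Comparison of the levels of `X` and `G` -/

theorem RetTrivial.of_ybGroup {k : ℕ} (h : S.ybGroup.toSymmetricSet.RetTrivial k) :
    S.RetTrivial k := fun x y => ybRel_ι_iff.1 (h (S.ι x) (S.ι y))

/-- Common criterion for both upper bounds on the level of `G`: generators go to generators under
the action, so only the orbits of `G` on `X` matter. -/
theorem retTrivial_ybGroup_succ {k : ℕ}
    (h : ∀ a b x, S.RetRel k (S.lhom a x) (S.lhom b x)) :
    S.ybGroup.toSymmetricSet.RetTrivial (k + 1) := fun (a b : S.YB) => ybRel_succ_of_ι fun x => by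
  rw [gact_ι, gact_ι, ybRel_ι_iff]
  exact h a b x

theorem RetTrivial.ybGroup_succ {k : ℕ} (h : S.RetTrivial k) :
    S.ybGroup.toSymmetricSet.RetTrivial (k + 1) :=
  retTrivial_ybGroup_succ fun _ _ _ => h _ _

/-- A generator has nonzero cocycle value, hence differs from `1`. This makes the level of `G` at
least one. -/
theorem not_retTrivial_ybGroup_zero : ¬ S.ybGroup.toSymmetricSet.RetTrivial 0 := by
  intro h
  obtain ⟨x⟩ := S.nonempty
  have h1 : S.ι x = 1 := h (S.ι x) (1 : S.YB)
  have h2 := congrArg S.cocycle h1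
  rw [cocycle_ι, cocycle_one] at h2
  exact FreeAbelianGroup.of_ne_zero x h2

/-- If all `ℒ_x` act trivially on `Ret^k(X, r)`, then so does `G(X, r)`. -/
theorem retRel_lhom {k : ℕ} (h : ∀ x y, S.RetRel k (S.act x y) y) (a : S.YB) (x : S.carrier) :
    S.RetRel k (S.lhom a x) x := by
  induction a using S.yb_induction generalizing x with
  | one =>
    rw [map_one]
    rfl
  | mul a y ih =>
    rw [map_mul, lhom_ι]
    exact (ih _).trans (h y x)
  | inv a y ih =>
    rw [map_mul, map_inv, lhom_ι]
    -- With `w = ℒ_y⁻¹ x`, the hypothesis on `ℒ_y` at `w` says `x ~_k w`.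
    refine (ih _).trans ((h y _).symm.trans ?_)
    rw [← perm_apply, perm_apply_inv_self]

/-- If `a` fixes `y`, then `x ~_{k+1} a` yields `ˣy ~_k ᵃy = y`. This saves the one level lost in
`RetTrivial.ybGroup_succ`. -/
theorem ConditionStar.retTrivial_ybGroup (hS : S.ConditionStar) {k : ℕ}
    (h : S.RetTrivial (k + 1)) : S.ybGroup.toSymmetricSet.RetTrivial (k + 1) := by
  have h1 : ∀ x y, S.RetRel k (S.act x y) y := by
    intro x y
    obtain ⟨a, ha⟩ := hS y
    have h2 := retRel_succ.1 (h x a) y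
    rwa [ha] at h2
  exact retTrivial_ybGroup_succ fun a b x => (retRel_lhom h1 a x).trans (retRel_lhom h1 b x).symm

theorem IsSquareFree.conditionStar (hS : S.IsSquareFree) : S.ConditionStar :=
  fun x => ⟨x, congrArg Prod.fst (hS x)⟩

/-! ### The permutation group as the retraction of `G` -/

/-- The action on `G` is the additive extension of the action on `X`, and the latter is recovered on
the generators because `ι` is injective. -/
theorem lhom_eq_iff {a b : S.YB} : S.lhom a = S.lhom b ↔ ∀ c, S.gact a c = S.gact b c := by
  constructor
  · intro h c
    apply S.cocycle_injective
    rw [cocycle_gact, cocycle_gact, h]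
  · intro h
    ext x
    apply ι_injective (S := S)
    rw [← gact_ι, ← gact_ι, h]

/-- `a` and `b` have the same image in `Ret^k(𝒢, r_𝒢)`. -/
def PermGRel (k : ℕ) (a b : S.PermG) : Prop := S.permGroup.toSymmetricSet.RetRel k a b

theorem permGRel_succ {k : ℕ} {a b : S.PermG} :
    PermGRel (k + 1) a b ↔ ∀ c, PermGRel k (S.permσ (a, c)).1 (S.permσ (b, c)).1 := retRel_succ

/-- Equality in `𝒢` is already the first retraction relation on `G`, which accounts for the shift.
It persists up the tower since `r_𝒢` is induced by `r_G`. -/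
theorem permGRel_toPermG {k : ℕ} {a b : S.YB} :
    PermGRel k (S.toPermG a) (S.toPermG b) ↔ YBRel (k + 1) a b := by
  induction k generalizing a b with
  | zero =>
    rw [ybRel_succ]
    exact Subtype.ext_iff.trans lhom_eq_iff
  | succ k ih =>
    rw [permGRel_succ, ybRel_succ, S.toPermG_surjective.forall]
    refine forall_congr' fun c => ?_
    rw [permσ_apply, permσ_apply, ih]
    rfl

/-- `Ret(G, r_G)` is isomorphic to `(𝒢, r_𝒢)`. -/
theorem retTrivial_permGroup_iff {k : ℕ} :
    S.permGroup.toSymmetricSet.RetTrivial k ↔ S.ybGroup.toSymmetricSet.RetTrivial (k + 1) :=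
  S.toPermG_surjective.forall.trans <| forall_congr' fun _ =>
    S.toPermG_surjective.forall.trans <| forall_congr' fun _ => permGRel_toPermG

end YBGroup

end SymmetricSet

/-! ### The main theorem -/

open SymmetricSet in
theorem ybGroup_hasMpl_iff_of_conditionStar {S : SymmetricSet.{u}} (hX : Nontrivial S.carrier)
    (hS : S.ConditionStar) (m : ℕ) : S.HasMpl m ↔ S.ybGroup.toSymmetricSet.HasMpl m := by
  have h : ∀ k, S.RetTrivial k ↔ S.ybGroup.toSymmetricSet.RetTrivial k := by
    refine fun k => ⟨fun hk => ?_, RetTrivial.of_ybGroup⟩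
    cases k with
    | zero =>
      -- Here `|X| ≥ 2` is essential: a one-element `X` has level `0`, while `G` is then infinite
      -- cyclic of level `1`.
      obtain ⟨x, y, hxy⟩ := hX
      exact absurd (hk x y) hxy
    | succ k => exact hS.retTrivial_ybGroup hk
  simp only [hasMpl_iff, h]

open SymmetricSet in
theorem mainTheorem4 (S : SymmetricSet.{u}) (hS : Nontrivial S.carrier) :
    (S.ybGroup.toSymmetricSet.IsMultipermutation ↔ S.IsMultipermutation) ∧
    (∀ m : ℕ, S.ybGroup.toSymmetricSet.HasMpl m →
      ∃ n k : ℕ, m = n + 1 ∧ S.permGroup.toSymmetricSet.HasMpl n ∧ S.HasMpl k ∧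
        n ≤ k ∧ k ≤ m) ∧
    (S.ConditionStar → ∀ m : ℕ, S.HasMpl m ↔ S.ybGroup.toSymmetricSet.HasMpl m) ∧
    (S.IsSquareFree → ∀ m : ℕ, S.HasMpl m ↔ S.ybGroup.toSymmetricSet.HasMpl m) := by
  refine ⟨?_, ?_, ybGroup_hasMpl_iff_of_conditionStar hS,
    fun h => ybGroup_hasMpl_iff_of_conditionStar hS h.conditionStar⟩
  · rw [isMultipermutation_iff, isMultipermutation_iff]
    exact ⟨fun ⟨k, h⟩ => ⟨k, h.of_ybGroup⟩, fun ⟨k, h⟩ => ⟨k + 1, h.ybGroup_succ⟩⟩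
  · intro m hm
    rw [hasMpl_iff] at hm
    obtain _ | n := m
    · exact absurd hm.1 not_retTrivial_ybGroup_zero
    · have hX : S.RetTrivial (n + 1) := RetTrivial.of_ybGroup hm.1
      obtain ⟨k, hk⟩ := isMultipermutation_iff.2 ⟨_, hX⟩
      have hk' := hasMpl_iff.1 hk
      refine ⟨n, k, rfl, hasMpl_iff.2 ⟨retTrivial_permGroup_iff.2 hm.1, fun j hj => ?_⟩, hk,
        ?_, hk'.2 hX⟩
      · exact Nat.le_of_succ_le_succ (hm.2 (retTrivial_permGroup_iff.1 hj))
      -- `Ret^{k+1}(G)` is trivial, so minimality of `n + 1` for `G` gives `n + 1 ≤ k + 1`.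
      · exact Nat.le_of_succ_le_succ (hm.2 hk'.1.ybGroup_succ)
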